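/- For a group $G$ let $\mathbb Z[G]$ be its integral group ring, $\mathfrak g$ the augmentation ideal, and let $\gamma_1(G)=G$, $\gamma_{k+1}(G)=[\gamma_k(G),G]$. For a normal subgroup $N$ of a group $E$ and $n\ge 0$, the $n$-th dimension subgroup of $E$ relative to $N$ is $$D_n(E,N)=E\cap(1+\mathfrak n\mathfrak e+\mathfrak e^n),$$ where $\mathfrak e$ is the augmentation ideal of $\mathbb Z[E]$ and $\mathfrak n$ that of $\mathbb Z[N]$, viewed in $\mathbb Z[E]$. For $m\ge 0$ the polynomial bar construction of degree $m$ of $\mathbb Z[G]$ is the complex with $P_mB_0=0$ and, for $i\ge1$, $$P_mB_i=\mathbb Z[G]/\mathfrak g^{m+1}\otimes(\mathfrak g/\mathfrak g^{m+1})^{\otimes (i-1)}\otimes \mathfrak g/\mathfrak g^{m+2}$$ (tensor products over $\mathbb Z$), with differential $\bar a_0\otimes\cdots\otimes\bar a_i\mapsto\sum_{j=0}^{i-1}(-1)^j\,\bar a_0\otimes\cdots\otimes\overline{a_ja_{j+1}}\otimes\cdots\otimes\bar a_i$ for $i\ge 2$. Let $P_mH_2(G)=H_2(\mathbb Z\otimes_{\mathbb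 Z[G]}P_mB)$, with $\mathbb Z$ the trivial module, and let $$\rho^G_{m*}\colon H_2(G)=H_2(G,\mathbb Z)\to P_mH_2(G)$$ be the homomorphism induced by the map $[g_1|\cdots|g_i]\mapsto 1\otimes\overline{(g_1-1)}\otimes\cdots\otimes\overline{(g_i-1)}$ on bar chains. Let $n\ge2$, let $E$ be an $(n-1)$-step nilpotent group (i.e. $\gamma_n(E)=1$), let $C$ be a central subgroup of $E$, and let $G=E/C\gamma_{n-1}(E)$. Then $G$ is $(n-2)$-step nilpotent (i.e. $\gamma_{n-1}(G)=1$), and $D_n(E,C)\cap C\gamma_{n-1}(E)$ is a homomorphic image of $\operatorname{Ker}\rho^G_{n-2\,*}$, i.e. there is a surjective group homomorphism $$\operatorname{Ker}\big(\rho^G_{n-2\,*}\colon H_2(G)\to P_{n-2}H_2(G)\big)\twoheadrightarrow D_n(E,C)\cap C\gamma_{n-1}(E).$$ -/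

import Mathlib

open scoped TensorProduct

noncomputable section

universe u

namespace DimSub

/-! ### Augmentation ideals and relative dimension subgroups -/

/-- The augmentation ideal of the integral group ring `ℤ[G]`: the kernel of the ring homomorphism
`ℤ[G] → ℤ` sending every group element to `1`. -/
def augIdeal (G : Type u) [Group G] : Ideal (MonoidAlgebra ℤ G) :=
  RingHom.ker (MonoidAlgebra.lift ℤ ℤ G (1 : G →* ℤ))

instance (G : Type u) [Group G] : (augIdeal G).IsTwoSided := by
  unfold augIdeal; infer_instance

theorem of_sub_one_mem {G : Type u} [Group G] (g : G) :
    MonoidAlgebra.of ℤ G g - 1 ∈ augIdeal G := by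
  simp [augIdeal, RingHom.mem_ker]

/-- The image in `ℤ[E]` of the augmentation ideal of `ℤ[N]`, for a subgroup `N` of `E`. -/
def subAug {E : Type u} [Group E] (N : Subgroup E) : Submodule ℤ (MonoidAlgebra ℤ E) :=
  ((augIdeal N).restrictScalars ℤ).map
    (MonoidAlgebra.mapDomainAlgHom ℤ ℤ N.subtype).toLinearMap

/-- The additive subgroup `𝔫𝔢 + 𝔢ⁿ` of `ℤ[E]`. -/
def relAug {E : Type u} [Group E] (n : ℕ) (N : Subgroup E) : Submodule ℤ (MonoidAlgebra ℤ E) :=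
  subAug N * (augIdeal E).restrictScalars ℤ ⊔ (augIdeal E ^ n).restrictScalars ℤ

theorem relAug_mul_mem {E : Type u} [Group E] (n : ℕ) (N : Subgroup E)
    {x : MonoidAlgebra ℤ E} (hx : x ∈ relAug n N) (y : MonoidAlgebra ℤ E) :
    x * y ∈ relAug n N := by
  obtain ⟨a, ha, b, hb, rfl⟩ := Submodule.mem_sup.1 hx
  rw [add_mul]
  refine Submodule.add_mem_sup ?_ ?_
  · refine Submodule.mul_induction_on ha ?_ ?_
    · intro p hp q hq
      rw [mul_assoc]
      exact Submodule.mul_mem_mul hp (Ideal.mul_mem_right (I := augIdeal E) y hq)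
    · intro p q hp hq
      rw [add_mul]
      exact add_mem hp hq
  · exact Ideal.mul_mem_right (I := augIdeal E ^ n) y hb

/-- The `n`-th dimension subgroup of `E` relative to `N`:
`D_n(E, N) = E ∩ (1 + 𝔫𝔢 + 𝔢ⁿ)`. -/
def relDim {E : Type u} [Group E] (n : ℕ) (N : Subgroup E) : Subgroup E where
  carrier := {e | MonoidAlgebra.of ℤ E e - 1 ∈ relAug n N}
  one_mem' := by
    simp only [Set.mem_ofPred_eq, map_one, sub_self, zero_mem]
  mul_mem' := by
    intro a b ha hb
    have h : MonoidAlgebra.of ℤ E (a * b) - 1 =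
        (MonoidAlgebra.of ℤ E a - 1) * MonoidAlgebra.of ℤ E b + (MonoidAlgebra.of ℤ E b - 1) := by
      rw [map_mul]; noncomm_ring
    simp only [Set.mem_ofPred_eq] at *
    rw [h]
    exact add_mem (relAug_mul_mem n N ha _) hb
  inv_mem' := by
    intro a ha
    have h : MonoidAlgebra.of ℤ E a⁻¹ - 1 =
        -((MonoidAlgebra.of ℤ E a - 1) * MonoidAlgebra.of ℤ E a⁻¹) := by
      rw [sub_mul, ← map_mul, mul_inv_cancel, map_one, one_mul, neg_sub]
    simp only [Set.mem_ofPred_eq] at *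
    rw [h]
    exact neg_mem (relAug_mul_mem n N ha _)

theorem mem_relDim {E : Type u} [Group E] {n : ℕ} {N : Subgroup E} {e : E} :
    e ∈ relDim n N ↔ MonoidAlgebra.of ℤ E e - 1 ∈ relAug n N := Iff.rfl

/-- The lower central series with the usual indexing, `γ₁(G) = G`, `γ_{k+1}(G) = [γ_k(G), G]`
(for `k ≥ 1`). -/
def gam (G : Type u) [Group G] (k : ℕ) : Subgroup G :=
  (⊤ : Subgroup G).lowerCentralSeries (k - 1)

instance (G : Type u) [Group G] (k : ℕ) : (gam G k).Normal := by
  unfold gam; infer_instance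

theorem normal_of_central {E : Type u} [Group E] {C : Subgroup E}
    (h : C ≤ Subgroup.center E) : C.Normal :=
  ⟨fun c hc g => by
    have := (Subgroup.mem_center_iff.1 (h hc)) g
    rw [this, mul_assoc, mul_inv_cancel, mul_one]; exact hc⟩

/-! ### The polynomial bar construction in degrees `≤ 3` -/

section Bar

variable {A : Type u} [Ring A] (J : Ideal A)

/-- The left `A`-module `A / Jᵏ`. -/
def RingQuot (k : ℕ) : Type u := A ⧸ J ^ k

instance (k : ℕ) : AddCommGroup (RingQuot J k) := inferInstanceAs (AddCommGroup (A ⧸ J ^ k))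
instance (k : ℕ) : Module A (RingQuot J k) := inferInstanceAs (Module A (A ⧸ J ^ k))

/-- The class of `a ∈ A` in `A / Jᵏ`. -/
def rmk (k : ℕ) : A →ₗ[A] RingQuot J k := Submodule.mkQ (J ^ k)

theorem rmk_surjective (k : ℕ) : Function.Surjective (rmk J k) := Submodule.mkQ_surjective _

theorem rmk_eq_zero {k : ℕ} {a : A} : rmk J k a = 0 ↔ a ∈ J ^ k :=
  Submodule.Quotient.mk_eq_zero _

/-- The left `A`-module `J / Jᵏ` (for `k ≥ 1`; here `J ∩ Jᵏ = Jᵏ`). -/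
def PowQuot (k : ℕ) : Type u := ↥J ⧸ Submodule.comap (Submodule.subtype J) (J ^ k)

instance (k : ℕ) : AddCommGroup (PowQuot J k) :=
  inferInstanceAs (AddCommGroup (↥J ⧸ Submodule.comap (Submodule.subtype J) (J ^ k)))
instance (k : ℕ) : Module A (PowQuot J k) :=
  inferInstanceAs (Module A (↥J ⧸ Submodule.comap (Submodule.subtype J) (J ^ k)))

/-- The class of `a ∈ J` in `J / Jᵏ`. -/
def pmk (k : ℕ) : J →ₗ[A] PowQuot J k := Submodule.mkQ _

theorem pmk_surjective (k : ℕ) : Function.Surjective (pmk J k) := Submodule.mkQ_surjective _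

theorem pmk_eq_zero {k : ℕ} {a : J} : pmk J k a = 0 ↔ (a : A) ∈ J ^ k :=
  Submodule.Quotient.mk_eq_zero _

/-- The map `J / Jᵏ → A / Jᵏ` induced by the inclusion. -/
def incl (k : ℕ) : PowQuot J k →ₗ[A] RingQuot J k :=
  Submodule.mapQ _ _ (Submodule.subtype J) le_rfl

theorem incl_pmk (k : ℕ) (a : J) : incl J k (pmk J k a) = rmk J k a := rfl

/-- For an additive map `f : M → N` to a left `A`-module `N`, the `A`-linear map `a ↦ a f`
from `A` to the additive maps `M → N`. -/
def actOn {M N : Type u} [AddCommGroup M] [AddCommGroup N] [Module A N] (f : M →ₗ[ℤ] N) :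
    A →ₗ[A] M →ₗ[ℤ] N where
  toFun a := a • f
  map_add' a b := add_smul a b f
  map_smul' a b := mul_smul a b f

/-- Multiplication `J / Jᵏ × J / Jˡ → J / Jˡ`, for `l ≤ k + 1`. -/
def mulJ {k l : ℕ} (h : l ≤ k + 1) : PowQuot J k →ₗ[A] PowQuot J l →ₗ[ℤ] PowQuot J l :=
  Submodule.liftQ _ ((actOn (LinearMap.id : PowQuot J l →ₗ[ℤ] PowQuot J l)).comp
      (Submodule.subtype J)) (by
    intro a ha
    rw [LinearMap.mem_ker]
    refine LinearMap.ext fun x => ?_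
    obtain ⟨y, rfl⟩ := pmk_surjective J l x
    change (a : A) • pmk J l y = 0
    rw [← map_smul, pmk_eq_zero]
    refine Ideal.pow_le_pow_right h ?_
    rw [Submodule.pow_succ]
    exact Ideal.mul_mem_mul ha y.2)

theorem mulJ_mk {k l : ℕ} (h : l ≤ k + 1) (a b : J) :
    mulJ J h (pmk J k a) (pmk J l b) = pmk J l ((a : A) • b) := rfl

variable [J.IsTwoSided]

/-- Multiplication `A / Jᵏ × J / Jᵏ → A / Jᵏ`. -/
def mulA (k : ℕ) : RingQuot J k →ₗ[A] PowQuot J k →ₗ[ℤ] RingQuot J k :=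
  Submodule.liftQ (J ^ k) (actOn ((incl J k).restrictScalars ℤ)) (by
    intro a ha
    rw [LinearMap.mem_ker]
    refine LinearMap.ext fun x => ?_
    obtain ⟨y, rfl⟩ := pmk_surjective J k x
    change a • incl J k (pmk J k y) = 0
    rw [incl_pmk, ← map_smul, rmk_eq_zero]
    exact Ideal.mul_mem_right (I := J ^ k) _ ha)

theorem mulA_mk (k : ℕ) (a : A) (b : J) :
    mulA J k (rmk J k a) (pmk J k b) = rmk J k (a * b) := rfl

variable (n : ℕ)

/-- `P_nB₁ = A/Jⁿ⁺¹ ⊗ J/Jⁿ⁺²`. -/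
abbrev PB1 : Type u := RingQuot J (n + 1) ⊗[ℤ] PowQuot J (n + 2)

/-- `P_nB₂ = A/Jⁿ⁺¹ ⊗ J/Jⁿ⁺¹ ⊗ J/Jⁿ⁺²`. -/
abbrev PB2 : Type u :=
  RingQuot J (n + 1) ⊗[ℤ] (PowQuot J (n + 1) ⊗[ℤ] PowQuot J (n + 2))

/-- `P_nB₃ = A/Jⁿ⁺¹ ⊗ J/Jⁿ⁺¹ ⊗ J/Jⁿ⁺¹ ⊗ J/Jⁿ⁺²`. -/
abbrev PB3 : Type u :=
  RingQuot J (n + 1) ⊗[ℤ]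
    (PowQuot J (n + 1) ⊗[ℤ] (PowQuot J (n + 1) ⊗[ℤ] PowQuot J (n + 2)))

/-- `a₀ ⊗ (a₁ ⊗ x) ↦ a₀a₁ ⊗ x`, the first face of the bar construction. -/
def face0 (X : Type u) [AddCommGroup X] :
    RingQuot J (n + 1) ⊗[ℤ] (PowQuot J (n + 1) ⊗[ℤ] X) →ₗ[A] RingQuot J (n + 1) ⊗[ℤ] X :=
  (TensorProduct.AlgebraTensorModule.map
      (TensorProduct.AlgebraTensorModule.lift (mulA J (n + 1)))
      (LinearMap.id : X →ₗ[ℤ] X)).comp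
    (TensorProduct.AlgebraTensorModule.assoc ℤ ℤ A (RingQuot J (n + 1))
      (PowQuot J (n + 1)) X).symm.toLinearMap

/-- `a₁ ⊗ a₂ ↦ a₁a₂`. -/
def inner2 : PowQuot J (n + 1) ⊗[ℤ] PowQuot J (n + 2) →ₗ[ℤ] PowQuot J (n + 2) :=
  TensorProduct.lift ((mulJ J (le_refl (n + 1 + 1))).restrictScalars ℤ)

/-- `a₁ ⊗ a₂ ⊗ a₃ ↦ a₁a₂ ⊗ a₃`. -/
def inner3a : PowQuot J (n + 1) ⊗[ℤ] (PowQuot J (n + 1) ⊗[ℤ] PowQuot J (n + 2)) →ₗ[ℤ]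
    PowQuot J (n + 1) ⊗[ℤ] PowQuot J (n + 2) :=
  (TensorProduct.map
      (TensorProduct.lift ((mulJ J (Nat.le_succ (n + 1))).restrictScalars ℤ))
      LinearMap.id).comp
    (TensorProduct.assoc ℤ (PowQuot J (n + 1)) (PowQuot J (n + 1))
      (PowQuot J (n + 2))).symm.toLinearMap

/-- `a₁ ⊗ a₂ ⊗ a₃ ↦ a₁ ⊗ a₂a₃`. -/
def inner3b : PowQuot J (n + 1) ⊗[ℤ] (PowQuot J (n + 1) ⊗[ℤ] PowQuot J (n + 2)) →ₗ[ℤ]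
    PowQuot J (n + 1) ⊗[ℤ] PowQuot J (n + 2) :=
  TensorProduct.map LinearMap.id (inner2 J n)

/-- `a₀ ⊗ a₁ ⊗ a₂ ↦ a₀a₁ ⊗ a₂ - a₀ ⊗ a₁a₂`. -/
def delta2 : PB2 J n →ₗ[A] PB1 J n :=
  face0 J n (PowQuot J (n + 2)) -
    TensorProduct.AlgebraTensorModule.map LinearMap.id (inner2 J n)

/-- `a₀ ⊗ a₁ ⊗ a₂ ⊗ a₃ ↦ a₀a₁ ⊗ a₂ ⊗ a₃ - a₀ ⊗ a₁a₂ ⊗ a₃ + a₀ ⊗ a₁ ⊗ a₂a₃`. -/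
def delta3 : PB3 J n →ₗ[A] PB2 J n :=
  face0 J n (PowQuot J (n + 1) ⊗[ℤ] PowQuot J (n + 2)) -
    TensorProduct.AlgebraTensorModule.map LinearMap.id (inner3a J n) +
    TensorProduct.AlgebraTensorModule.map LinearMap.id (inner3b J n)

theorem delta2_tmul (a : A) (b c : J) :
    delta2 J n (rmk J (n + 1) a ⊗ₜ (pmk J (n + 1) b ⊗ₜ pmk J (n + 2) c)) =
      rmk J (n + 1) (a * b) ⊗ₜ pmk J (n + 2) c -
        rmk J (n + 1) a ⊗ₜ pmk J (n + 2) ((b : A) • c) := rfl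

theorem delta3_tmul (a : A) (b c d : J) :
    delta3 J n (rmk J (n + 1) a ⊗ₜ
        (pmk J (n + 1) b ⊗ₜ (pmk J (n + 1) c ⊗ₜ pmk J (n + 2) d))) =
      rmk J (n + 1) (a * b) ⊗ₜ (pmk J (n + 1) c ⊗ₜ pmk J (n + 2) d) -
        rmk J (n + 1) a ⊗ₜ (pmk J (n + 1) ((b : A) • c) ⊗ₜ pmk J (n + 2) d) +
        rmk J (n + 1) a ⊗ₜ (pmk J (n + 1) b ⊗ₜ pmk J (n + 2) ((c : A) • d)) := rfl

theorem delta2_delta3 (x : PB3 J n) : delta2 J n (delta3 J n x) = 0 := by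
  induction x using TensorProduct.induction_on with
  | zero => simp
  | add x y hx hy => rw [map_add, map_add, hx, hy, add_zero]
  | tmul a x =>
    induction x using TensorProduct.induction_on with
    | zero => simp
    | add x y hx hy => rw [TensorProduct.tmul_add, map_add, map_add, hx, hy, add_zero]
    | tmul b x =>
      induction x using TensorProduct.induction_on with
      | zero => simp
      | add x y hx hy =>
        rw [TensorProduct.tmul_add, TensorProduct.tmul_add, map_add, map_add, hx, hy, add_zero]
      | tmul c d =>
        obtain ⟨a, rfl⟩ := rmk_surjective J _ a
        obtain ⟨b, rfl⟩ := pmk_surjective J _ b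
        obtain ⟨c, rfl⟩ := pmk_surjective J _ c
        obtain ⟨d, rfl⟩ := pmk_surjective J _ d
        rw [delta3_tmul, map_add, map_sub, delta2_tmul, delta2_tmul, delta2_tmul]
        simp only [Submodule.coe_smul, smul_eq_mul, mul_assoc, mul_smul]
        abel

/-- `ℤ ⊗_A M = M / JM`, for a left `A`-module `M`, where `ℤ` is the right `A`-module `A / J`
(if `A = ℤ[G]` and `J` is the augmentation ideal, the trivial module). If `Jⁿ⁺¹M = 0`, this is
also the tensor product over `A / Jⁿ⁺¹`. -/
def Coinv (J : Ideal A) (M : Type u) [AddCommGroup M] [Module A M] : Type u :=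
  M ⧸ (J • (⊤ : Submodule A M))

section Coinv

variable (J : Ideal A) {M N : Type u} [AddCommGroup M] [Module A M] [AddCommGroup N] [Module A N]

instance : AddCommGroup (Coinv J M) :=
  inferInstanceAs (AddCommGroup (M ⧸ (J • (⊤ : Submodule A M))))
instance : Module A (Coinv J M) :=
  inferInstanceAs (Module A (M ⧸ (J • (⊤ : Submodule A M))))

/-- The class `1 ⊗ m` of `m ∈ M` in `ℤ ⊗_A M`. -/
def cmk : M →ₗ[A] Coinv J M := Submodule.mkQ _

theorem cmk_surjective : Function.Surjective (cmk J (M := M)) := Submodule.mkQ_surjective _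

theorem cmk_eq_zero {m : M} : cmk J m = 0 ↔ m ∈ J • (⊤ : Submodule A M) :=
  Submodule.Quotient.mk_eq_zero _

/-- The map `ℤ ⊗_A M → ℤ ⊗_A N` induced by an `A`-linear map `M → N`. -/
def coinvMap (f : M →ₗ[A] N) : Coinv J M →ₗ[A] Coinv J N :=
  Submodule.mapQ _ _ f (by
    rw [← Submodule.map_le_iff_le_comap, Submodule.map_smul'']
    exact smul_mono_right _ le_top)

theorem coinvMap_cmk (f : M →ₗ[A] N) (m : M) : coinvMap J f (cmk J m) = cmk J (f m) := rfl

end Coinv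

/-- The second polynomial homology group `P_nH₂` with coefficients in `A / J`: the homology of
`ℤ ⊗ P_nB₃ → ℤ ⊗ P_nB₂ → ℤ ⊗ P_nB₁` at the middle term. -/
def PolyH2 : Type u :=
  ↥(LinearMap.ker (coinvMap J (delta2 J n))) ⧸
    (LinearMap.range (coinvMap J (delta3 J n))).submoduleOf
      (LinearMap.ker (coinvMap J (delta2 J n)))

instance : AddCommGroup (PolyH2 J n) :=
  inferInstanceAs (AddCommGroup (↥(LinearMap.ker (coinvMap J (delta2 J n))) ⧸
    (LinearMap.range (coinvMap J (delta3 J n))).submoduleOf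
      (LinearMap.ker (coinvMap J (delta2 J n)))))

/-- The homology class of a 2-cycle of the complex `ℤ ⊗ P_nB`. -/
def hmk : ↥(LinearMap.ker (coinvMap J (delta2 J n))) →+ PolyH2 J n :=
  (Submodule.mkQ ((LinearMap.range (coinvMap J (delta3 J n))).submoduleOf
      (LinearMap.ker (coinvMap J (delta2 J n))))).toAddMonoidHom

theorem hmk_surjective : Function.Surjective (hmk J n) := Submodule.mkQ_surjective _

theorem hmk_eq_zero {x : ↥(LinearMap.ker (coinvMap J (delta2 J n)))} :
    hmk J n x = 0 ↔ ∃ y, coinvMap J (delta3 J n) y = x.1 :=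
  (Submodule.Quotient.mk_eq_zero _).trans Iff.rfl

end Bar

/-! ### The comparison map `H₂(G) → P_nH₂(G)` -/

section Rho

variable (G : Type u) [Group G] (n : ℕ)

/-- The trivial representation `ℤ` of `G`; the ring `ℤ` is lifted to the universe of `G`, as
Mathlib's group homology requires. -/
abbrev trivZ : Rep (ULift.{u} ℤ) G := Rep.trivial (ULift.{u} ℤ) G (ULift.{u} ℤ)

/-- The element `g - 1` of the augmentation ideal. -/
def dif {G : Type u} [Group G] (g : G) : augIdeal G :=
  ⟨MonoidAlgebra.of ℤ G g - 1, of_sub_one_mem g⟩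

theorem dif_mul {G : Type u} [Group G] (g h : G) :
    dif (g * h) = dif g + dif h + ((dif g : augIdeal G) : MonoidAlgebra ℤ G) • dif h := by
  apply Subtype.ext
  simp only [dif, map_mul, Submodule.coe_add, Submodule.coe_smul, smul_eq_mul]
  noncomm_ring

/-- The class of `1 ⊗ (g - 1)` in `ℤ ⊗_G P_nB₁`. -/
def rhoGen1 (g : G) : Coinv (augIdeal G) (PB1 (augIdeal G) n) :=
  cmk _ (rmk (augIdeal G) (n + 1) 1 ⊗ₜ pmk (augIdeal G) (n + 2) (dif g))

/-- The class of `1 ⊗ (g - 1) ⊗ (h - 1)` in `ℤ ⊗_G P_nB₂`. -/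
def rhoGen2 (p : G × G) : Coinv (augIdeal G) (PB2 (augIdeal G) n) :=
  cmk _
    (rmk (augIdeal G) (n + 1) 1 ⊗ₜ
      (pmk (augIdeal G) (n + 1) (dif p.1) ⊗ₜ pmk (augIdeal G) (n + 2) (dif p.2)))

/-- The class of `1 ⊗ (g - 1) ⊗ (h - 1) ⊗ (k - 1)` in `ℤ ⊗_G P_nB₃`. -/
def rhoGen3 (p : G × G × G) : Coinv (augIdeal G) (PB3 (augIdeal G) n) :=
  cmk _
    (rmk (augIdeal G) (n + 1) 1 ⊗ₜ
      (pmk (augIdeal G) (n + 1) (dif p.1) ⊗ₜ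
        (pmk (augIdeal G) (n + 1) (dif p.2.1) ⊗ₜ pmk (augIdeal G) (n + 2) (dif p.2.2))))

theorem coinv_zero {A : Type u} [Ring A] (J : Ideal A) (k : ℕ) (X : Type u) [AddCommGroup X]
    (a : J) (x : X) :
    (cmk _ (rmk J k (1 * (a : A)) ⊗ₜ[ℤ] x) :
      Coinv J (RingQuot J k ⊗[ℤ] X)) = 0 := by
  have h : rmk J k (1 * (a : A)) ⊗ₜ[ℤ] x = (a : A) • (rmk J k 1 ⊗ₜ[ℤ] x) := by
    rw [TensorProduct.smul_tmul', ← map_smul, smul_eq_mul, one_mul, mul_one]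
  rw [h, cmk_eq_zero]
  exact Submodule.smul_mem_smul a.2 trivial

theorem coinvMap_delta2_rhoGen2 (g h : G) :
    coinvMap (augIdeal G) (delta2 (augIdeal G) n) (rhoGen2 G n (g, h)) =
      rhoGen1 G n h - rhoGen1 G n (g * h) + rhoGen1 G n g := by
  rw [rhoGen2, coinvMap_cmk, delta2_tmul, map_sub, coinv_zero]
  simp only [rhoGen1, dif_mul, map_add, TensorProduct.tmul_add]
  abel

theorem coinvMap_delta3_rhoGen3 (g h k : G) :
    coinvMap (augIdeal G) (delta3 (augIdeal G) n) (rhoGen3 G n (g, h, k)) =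
      rhoGen2 G n (h, k) - rhoGen2 G n (g * h, k) + rhoGen2 G n (g, h * k)
        - rhoGen2 G n (g, h) := by
  rw [rhoGen3, coinvMap_cmk, delta3_tmul, map_add, map_sub, coinv_zero]
  simp only [rhoGen2, dif_mul, map_add, TensorProduct.tmul_add, TensorProduct.add_tmul]
  abel

/-- The comparison map on 1-chains, `x[g] ↦ x ⊗ (g - 1)`. -/
def rhoChain1 : (G →₀ ULift.{u} ℤ) →ₗ[ULift.{u} ℤ] Coinv (augIdeal G) (PB1 (augIdeal G) n) :=
  Finsupp.linearCombination (ULift.{u} ℤ) (rhoGen1 G n)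

/-- The comparison map on 2-chains, `x[g | h] ↦ x ⊗ (g - 1) ⊗ (h - 1)`. -/
def rhoChain2 : (G × G →₀ ULift.{u} ℤ) →ₗ[ULift.{u} ℤ]
    Coinv (augIdeal G) (PB2 (augIdeal G) n) :=
  Finsupp.linearCombination (ULift.{u} ℤ) (rhoGen2 G n)

/-- The comparison map on 3-chains, `x[g | h | k] ↦ x ⊗ (g - 1) ⊗ (h - 1) ⊗ (k - 1)`. -/
def rhoChain3 : (G × G × G →₀ ULift.{u} ℤ) →ₗ[ULift.{u} ℤ]
    Coinv (augIdeal G) (PB3 (augIdeal G) n) :=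
  Finsupp.linearCombination (ULift.{u} ℤ) (rhoGen3 G n)

theorem map_usmul {M N : Type u} [AddCommGroup M] [AddCommGroup N] {F : Type u} [FunLike F M N]
    [AddMonoidHomClass F M N] (f : F) (c : ULift.{u} ℤ) (x : M) : f (c • x) = c • f x := by
  rw [ULift.smul_def, ULift.smul_def, map_zsmul]

theorem delta2_rhoChain2 (x : G × G →₀ ULift.{u} ℤ) :
    coinvMap (augIdeal G) (delta2 (augIdeal G) n) (rhoChain2 G n x) =
      rhoChain1 G n ((groupHomology.d₂₁ (trivZ G)).hom x) := by
  induction x using Finsupp.induction_linear with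
  | zero => simp
  | add x y hx hy =>
    rw [map_add, map_add, hx, hy, ← map_add]
    exact congrArg (rhoChain1 G n) (map_add (groupHomology.d₂₁ (trivZ G)).hom x y).symm
  | single p c =>
    obtain ⟨g, h⟩ := p
    have e : (groupHomology.d₂₁ (trivZ G)).hom (Finsupp.single (g, h) c) =
        (Finsupp.single h c - Finsupp.single (g * h) c + Finsupp.single g c :
          G →₀ ULift.{u} ℤ) :=
      groupHomology.d₂₁_single (A := trivZ G) (g, h) c
    refine Eq.trans ?_ (congrArg (rhoChain1 G n) e.symm)
    rw [rhoChain2, rhoChain1, Finsupp.linearCombination_single, map_usmul,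
      coinvMap_delta2_rhoGen2, map_add, map_sub]
    simp only [Finsupp.linearCombination_single, smul_add, smul_sub]

theorem delta3_rhoChain3 (x : G × G × G →₀ ULift.{u} ℤ) :
    coinvMap (augIdeal G) (delta3 (augIdeal G) n) (rhoChain3 G n x) =
      rhoChain2 G n ((groupHomology.d₃₂ (trivZ G)).hom x) := by
  induction x using Finsupp.induction_linear with
  | zero => simp
  | add x y hx hy =>
    rw [map_add, map_add, hx, hy, ← map_add]
    exact congrArg (rhoChain2 G n) (map_add (groupHomology.d₃₂ (trivZ G)).hom x y).symm
  | single p c =>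
    obtain ⟨g, h, k⟩ := p
    have e : (groupHomology.d₃₂ (trivZ G)).hom (Finsupp.single (g, h, k) c) =
        (Finsupp.single (h, k) c - Finsupp.single (g * h, k) c + Finsupp.single (g, h * k) c
          - Finsupp.single (g, h) c : G × G →₀ ULift.{u} ℤ) :=
      groupHomology.d₃₂_single (A := trivZ G) (g, h, k) c
    refine Eq.trans ?_ (congrArg (rhoChain2 G n) e.symm)
    rw [rhoChain3, rhoChain2, Finsupp.linearCombination_single, map_usmul,
      coinvMap_delta3_rhoGen3, map_sub, map_add, map_sub]
    simp only [Finsupp.linearCombination_single, smul_add, smul_sub]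

theorem rhoChain2_mem (x : groupHomology.cycles₂ (trivZ G)) :
    rhoChain2 G n x.1 ∈ LinearMap.ker (coinvMap (augIdeal G) (delta2 (augIdeal G) n)) := by
  have hx : (groupHomology.d₂₁ (trivZ G)).hom x.1 = 0 := x.2
  rw [LinearMap.mem_ker]
  exact ((delta2_rhoChain2 G n x.1).trans (congrArg (rhoChain1 G n) hx)).trans (map_zero _)

/-- The comparison map on 2-cycles. -/
def rhoCycles : groupHomology.cycles₂ (trivZ G) →+ PolyH2 (augIdeal G) n :=
  (hmk (augIdeal G) n).comp
    { toFun := fun x => ⟨rhoChain2 G n x.1, rhoChain2_mem G n x⟩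
      map_zero' := Subtype.ext (map_zero (rhoChain2 G n))
      map_add' := fun x y => Subtype.ext (map_add (rhoChain2 G n) x.1 y.1) }

theorem rhoCycles_boundaries (x : groupHomology.cycles₂ (trivZ G))
    (hx : x.1 ∈ groupHomology.boundaries₂ (trivZ G)) : rhoCycles G n x = 0 := by
  obtain ⟨y, hy⟩ := hx
  refine (hmk_eq_zero (augIdeal G) n).2 ⟨rhoChain3 G n y, ?_⟩
  rw [delta3_rhoChain3]
  exact congrArg (rhoChain2 G n) hy

/-- The quotient map from 2-cycles to `H₂(G)`, with kernel the 2-boundaries. -/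
def cyclesToH2 : groupHomology.cycles₂ (trivZ G) →+ groupHomology.H2 (trivZ G) :=
  (groupHomology.H2π (trivZ G)).hom.toAddMonoidHom

theorem cyclesToH2_surjective : Function.Surjective (cyclesToH2 G) := fun x =>
  groupHomology.H2_induction_on x fun y => ⟨y, rfl⟩

theorem cyclesToH2_eq_zero {x : groupHomology.cycles₂ (trivZ G)} :
    cyclesToH2 G x = 0 ↔ x.1 ∈ groupHomology.boundaries₂ (trivZ G) :=
  groupHomology.H2π_eq_zero_iff x

/-- The natural map `ρ_{n*} : H₂(G) → P_nH₂(G)` induced by the comparison map of chains: it sends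
the class of a 2-cycle `z` to the class of `rhoChain2 z`. -/
def rho : groupHomology.H2 (trivZ G) →+ PolyH2 (augIdeal G) n :=
  AddMonoidHom.liftOfSurjective (cyclesToH2 G) (cyclesToH2_surjective G) ⟨rhoCycles G n,
    fun _ hx => rhoCycles_boundaries G n _ ((cyclesToH2_eq_zero G).1 hx)⟩

theorem rho_cyclesToH2 (x : groupHomology.cycles₂ (trivZ G)) :
    rho G n (cyclesToH2 G x) = rhoCycles G n x :=
  AddMonoidHom.liftOfRightInverse_comp_apply _ _ _ _ x

end Rho

end DimSub

end

/-! Write n = m + 2, N = Cγ_{n-1}(E) and G = E/N; N is central because γ_n(E) = 1. Since 𝔢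
multiplied by d - 1, d ∈ γ_{n-1}(E), lands in 𝔢ⁿ, replacing C by N does not change 𝔠𝔢 + 𝔢ⁿ
(`relAug_sup_gam`). So it suffices to show that the transgression H₂(G) → N of the central extension
maps Ker ρ onto D_n(E, N) ∩ N.

The transgression is computed in ℤ[E]. Extend a normalised section of E → G additively to s : ℤ[G] →
ℤ[E] and send [g | h] to s(g - 1)s(h - 1). A cycle then goes into the kernel of ℤ[E] → ℤ[G], and
modulo 𝔫𝔢 this kernel is N, via x ↦ x - 1 (`adev_eq_zero`, `mkQ_eq_augClass_adev`). Although s is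
not multiplicative, s(bc)s(d) ≡ s(b)s(cd) modulo 𝔫𝔢 by centrality, so boundaries die.

Modulo 𝔫𝔢 + 𝔢ⁿ the same formula factors through the polynomial chains and kills their boundaries
(`polyChainLift_delta3`). Hence ρ(z) = 0 puts the transgression of z in D_n(E, N). Conversely, if x
- 1 = p + q with p ∈ 𝔫𝔢 and q ∈ 𝔢ⁿ, then q is a sum of products ab with a ∈ 𝔢ⁿ⁻¹ and b ∈ 𝔢. The
corresponding chain on G has zero polynomial image, since 𝔤ⁿ⁻¹ is factored out there; it is a cycle
because q projects to 0, and it transgresses to x (`exists_transgression_eq`). -/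

noncomputable section

universe u

namespace DimSub

open scoped IsMulCommutative

/-! ### Augmentation ideals, powers, and the lower central series -/

section GroupRing

variable {G : Type u} [Group G]

/-- The additive map `ℤ[G] → M` with prescribed values on the group elements. -/
def addExt {M : Type*} [AddCommGroup M] (f : G → M) : MonoidAlgebra ℤ G →ₗ[ℤ] M :=
  (Finsupp.linearCombination ℤ f).comp (MonoidAlgebra.coeffLinearEquiv ℤ).toLinearMap

theorem addExt_of {M : Type*} [AddCommGroup M] (f : G → M) (g : G) :
    addExt f (MonoidAlgebra.of ℤ G g) = f g := by
  simp [addExt]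

theorem linearMap_ext_of {M : Type*} [AddCommGroup M] {f f' : MonoidAlgebra ℤ G →ₗ[ℤ] M}
    (h : ∀ g, f (MonoidAlgebra.of ℤ G g) = f' (MonoidAlgebra.of ℤ G g)) : f = f' := by
  refine LinearMap.ext fun x => ?_
  induction x using MonoidAlgebra.induction_on with
  | of g => exact h g
  | add x y hx hy => rw [map_add, map_add, hx, hy]
  | smul r x hx => rw [map_smul, map_smul, hx]

/-- Subtracting its augmentation from any element of ℤ[G] leaves a combination of differences g - 1.
-/
theorem augIdeal_restrictScalars_eq_span :
    (augIdeal G).restrictScalars ℤ =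
      Submodule.span ℤ (Set.range fun g : G => MonoidAlgebra.of ℤ G g - 1) := by
  apply le_antisymm
  · intro x hx
    have key : ∀ x : MonoidAlgebra ℤ G, x - MonoidAlgebra.lift ℤ ℤ G (1 : G →* ℤ) x • 1 ∈
        Submodule.span ℤ (Set.range fun g : G => MonoidAlgebra.of ℤ G g - 1) := by
      intro x
      induction x using MonoidAlgebra.induction_on with
      | of g =>
        rw [MonoidAlgebra.lift_of, MonoidHom.one_apply, one_smul]
        exact Submodule.subset_span ⟨g, rfl⟩
      | add x y hx hy =>
        rw [map_add, add_smul, add_sub_add_comm]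
        exact add_mem hx hy
      | smul r x hx =>
        rw [map_smul, smul_assoc, ← smul_sub]
        exact Submodule.smul_mem _ r hx
    have h0 : MonoidAlgebra.lift ℤ ℤ G (1 : G →* ℤ) x = 0 := hx
    simpa [h0] using key x
  · rw [Submodule.span_le]
    rintro _ ⟨g, rfl⟩
    exact of_sub_one_mem g

theorem augIdeal_induction {p : augIdeal G → Prop} (hd : ∀ g, p (dif g)) (h0 : p 0)
    (hadd : ∀ a b, p a → p b → p (a + b)) (hneg : ∀ a, p a → p (-a)) (a : augIdeal G) : p a := by
  let S : AddSubgroup (augIdeal G) :=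
    { carrier := {a | p a}, zero_mem' := h0, add_mem' := hadd _ _, neg_mem' := hneg _ }
  have h : (augIdeal G).restrictScalars ℤ ≤
      (AddSubgroup.toIntSubmodule S).map ((augIdeal G).subtype.restrictScalars ℤ) := by
    rw [augIdeal_restrictScalars_eq_span, Submodule.span_le]
    rintro _ ⟨g, rfl⟩
    exact ⟨dif g, hd g, rfl⟩
  obtain ⟨b, hb, hba⟩ := h a.2
  obtain rfl : b = a := Subtype.ext hba
  exact hb

theorem subAug_eq_span (N : Subgroup G) :
    subAug N = Submodule.span ℤ ((fun g : G => MonoidAlgebra.of ℤ G g - 1) '' N) := by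
  rw [subAug, augIdeal_restrictScalars_eq_span, Submodule.map_span, ← Set.range_comp]
  rw [Set.image_eq_range]
  congr 2
  funext x
  change MonoidAlgebra.mapDomainAlgHom ℤ ℤ N.subtype (MonoidAlgebra.of ℤ N x - 1) = _
  rw [map_sub, map_one]
  simp

theorem of_sub_one_mem_subAug {N : Subgroup G} {g : G} (hg : g ∈ N) :
    MonoidAlgebra.of ℤ G g - 1 ∈ subAug N := by
  rw [subAug_eq_span]
  exact Submodule.subset_span ⟨g, hg, rfl⟩

theorem commute_of_mem_subAug {N : Subgroup G} (hN : N ≤ Subgroup.center G)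
    {x : MonoidAlgebra ℤ G} (hx : x ∈ subAug N) (y : MonoidAlgebra ℤ G) : x * y = y * x := by
  rw [subAug_eq_span] at hx
  induction hx using Submodule.span_induction with
  | mem x hx =>
    obtain ⟨g, hg, rfl⟩ := hx
    induction y using MonoidAlgebra.induction_on with
    | of h =>
      simp only [sub_mul, mul_sub, one_mul, mul_one, ← map_mul]
      rw [Subgroup.mem_center_iff.1 (hN hg) h]
    | add x y hx hy => rw [mul_add, add_mul, hx, hy]
    | smul r x hx => rw [mul_smul_comm, smul_mul_assoc, hx]
  | zero => simp
  | add x z _ _ hx hz => rw [mul_add, add_mul, hx, hz]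
  | smul r x _ hx => rw [mul_smul_comm, smul_mul_assoc, hx]

/-- The elements of the `k`-th term of the lower central series (counted from `0`) are congruent
to `1` modulo the `(k+1)`-st power of the augmentation ideal. -/
theorem of_sub_one_mem_pow (k : ℕ) {g : G} (hg : g ∈ (⊤ : Subgroup G).lowerCentralSeries k) :
    MonoidAlgebra.of ℤ G g - 1 ∈ augIdeal G ^ (k + 1) := by
  induction k generalizing g with
  | zero => rw [zero_add, Submodule.pow_one]; exact of_sub_one_mem g
  | succ k ih =>
    rw [Subgroup.mem_lowerCentralSeries_succ_iff] at hg
    induction hg using Subgroup.closure_induction with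
    | mem x hx =>
      obtain ⟨p, hp, q, -, rfl⟩ := hx
      -- A group commutator minus 1 is a ring commutator of p - 1 and q - 1 times a unit; both terms
      -- of the ring commutator gain one power of the ideal.
      have e : MonoidAlgebra.of ℤ G (p * q * p⁻¹ * q⁻¹) - 1 =
          ((MonoidAlgebra.of ℤ G p - 1) * (MonoidAlgebra.of ℤ G q - 1) -
            (MonoidAlgebra.of ℤ G q - 1) * (MonoidAlgebra.of ℤ G p - 1)) *
          MonoidAlgebra.of ℤ G (p⁻¹ * q⁻¹) := by
        have e1 : (MonoidAlgebra.of ℤ G p - 1) * (MonoidAlgebra.of ℤ G q - 1) -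
            (MonoidAlgebra.of ℤ G q - 1) * (MonoidAlgebra.of ℤ G p - 1) =
            MonoidAlgebra.of ℤ G (p * q) - MonoidAlgebra.of ℤ G (q * p) := by
          rw [map_mul, map_mul]; noncomm_ring
        rw [e1, sub_mul, ← map_mul, ← map_mul, 
          show q * p * (p⁻¹ * q⁻¹) = 1 by group, map_one, show p * q * (p⁻¹ * q⁻¹) =
            p * q * p⁻¹ * q⁻¹ by group]
      rw [commutatorElement_def, e]
      refine Ideal.mul_mem_right _ _ (sub_mem ?_ ?_)
      · rw [Submodule.pow_succ]
        exact Ideal.mul_mem_mul (ih hp) (of_sub_one_mem q)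
      · rw [Submodule.pow_succ' _ (Nat.succ_ne_zero k)]
        exact Ideal.mul_mem_mul (of_sub_one_mem q) (ih hp)
    | one => rw [map_one, sub_self]; exact zero_mem _
    | mul x y _ _ hx hy =>
      have e : MonoidAlgebra.of ℤ G (x * y) - 1 =
          (MonoidAlgebra.of ℤ G x - 1) * MonoidAlgebra.of ℤ G y + (MonoidAlgebra.of ℤ G y - 1) := by
        rw [map_mul]; noncomm_ring
      rw [e]
      exact add_mem (Ideal.mul_mem_right _ _ hx) hy
    | inv x _ hx =>
      have e : MonoidAlgebra.of ℤ G x⁻¹ - 1 =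
          -((MonoidAlgebra.of ℤ G x - 1) * MonoidAlgebra.of ℤ G x⁻¹) := by
        rw [sub_mul, ← map_mul, mul_inv_cancel, map_one, one_mul, neg_sub]
      rw [e]
      exact neg_mem (Ideal.mul_mem_right _ _ hx)

theorem relAug_mono {N N' : Subgroup G} (h : N ≤ N') (n : ℕ) : relAug n N ≤ relAug n N' := by
  refine sup_le_sup_right (mul_le_mul_left ?_ _) _
  rw [subAug_eq_span, subAug_eq_span]
  exact Submodule.span_mono (Set.image_mono h)

/-- Enlarging `C` by the `(n-1)`-st term of the lower central series does not change
`𝔠𝔢 + 𝔢ⁿ`. -/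
theorem relAug_sup_gam (C : Subgroup G) (m : ℕ) :
    relAug (m + 2) (C ⊔ gam G (m + 1)) = relAug (m + 2) C := by
  refine le_antisymm (sup_le ?_ le_sup_right) (relAug_mono le_sup_left _)
  rw [subAug_eq_span, Submodule.mul_le]
  intro x hx y hy
  induction hx using Submodule.span_induction with
  | mem x hx =>
    obtain ⟨g, hg, rfl⟩ := hx
    obtain ⟨c, hc, d, hd, rfl⟩ := Subgroup.mem_sup_of_normal_right.1 hg
    -- The first summand stays in 𝔠𝔢; in the second, d - 1 already has degree m + 1 and y supplies
    -- one more.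
    have e : (MonoidAlgebra.of ℤ G (c * d) - 1) * y =
        (MonoidAlgebra.of ℤ G c - 1) * (MonoidAlgebra.of ℤ G d * y) +
          (MonoidAlgebra.of ℤ G d - 1) * y := by
      rw [map_mul]; noncomm_ring
    simp only
    rw [e]
    refine Submodule.add_mem_sup ?_ ?_
    · exact Submodule.mul_mem_mul (of_sub_one_mem_subAug hc) (Ideal.mul_mem_left (augIdeal G) _ hy)
    · change _ ∈ augIdeal G ^ (m + 2)
      rw [Submodule.pow_succ]
      exact Ideal.mul_mem_mul (of_sub_one_mem_pow m hd) hy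
  | zero => simp
  | add x z _ _ hx hz => rw [add_mul]; exact add_mem hx hz
  | smul r x _ hx => rw [smul_mul_assoc]; exact Submodule.smul_mem _ r hx

end GroupRing

/-! ### The kernel of ℤ[E] → ℤ[E/N] modulo 𝔫𝔢, and the additive section -/

section CentralExtension

variable {E : Type u} [Group E] (N : Subgroup E)

/-- The additive subgroup `𝔫𝔢` of `ℤ[E]`. -/
def augMul : Submodule ℤ (MonoidAlgebra ℤ E) :=
  subAug N * (augIdeal E).restrictScalars ℤ

/-- The class of `x - 1` in `ℤ[E]/𝔫𝔢`, for `x ∈ N`. -/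
def augClass : Additive N →+ MonoidAlgebra ℤ E ⧸ augMul N :=
  AddMonoidHom.mk' (fun x => (augMul N).mkQ (MonoidAlgebra.of ℤ E (x.toMul : E) - 1)) (by
    intro x y
    rw [← map_add, ← sub_eq_zero, ← map_sub, Submodule.mkQ_apply, Submodule.Quotient.mk_eq_zero]
    have e : MonoidAlgebra.of ℤ E ((x + y).toMul : E) - 1 -
        (MonoidAlgebra.of ℤ E (x.toMul : E) - 1 + (MonoidAlgebra.of ℤ E (y.toMul : E) - 1)) =
        (MonoidAlgebra.of ℤ E (x.toMul : E) - 1) * (MonoidAlgebra.of ℤ E (y.toMul : E) - 1) := by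
      rw [toMul_add, Subgroup.coe_mul, map_mul]; noncomm_ring
    rw [e]
    exact Submodule.mul_mem_mul (of_sub_one_mem_subAug x.toMul.2) (of_sub_one_mem _))

theorem augClass_ofMul (x : N) :
    augClass N (Additive.ofMul x) = (augMul N).mkQ (MonoidAlgebra.of ℤ E (x : E) - 1) := rfl

theorem augMul_le_relAug (n : ℕ) : augMul N ≤ relAug n N := le_sup_left

theorem mem_relAug_of_mem_pow {n : ℕ} {a : MonoidAlgebra ℤ E} (ha : a ∈ augIdeal E ^ n) :
    a ∈ relAug n N := Submodule.mem_sup_right (T := (augIdeal E ^ n).restrictScalars ℤ) ha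

variable [N.Normal]

/-- The projection `ℤ[E] → ℤ[E/N]`. -/
def proj : MonoidAlgebra ℤ E →ₐ[ℤ] MonoidAlgebra ℤ (E ⧸ N) :=
  MonoidAlgebra.mapDomainAlgHom ℤ ℤ (QuotientGroup.mk' N)

theorem proj_of (e : E) : proj N (MonoidAlgebra.of ℤ E e) = MonoidAlgebra.of ℤ (E ⧸ N) e := by
  simp [proj]

/-- A section of `E → E/N`, normalised to send `1` to `1`. -/
def sec (g : E ⧸ N) : E := g.out * ((1 : E ⧸ N).out)⁻¹

theorem mk_sec (g : E ⧸ N) : ((sec N g : E) : E ⧸ N) = g := by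
  simp [sec]

theorem sec_one : sec N 1 = 1 := mul_inv_cancel _

/-- The additive section of `ℤ[E] → ℤ[E/N]` extending `sec`. -/
def asec : MonoidAlgebra ℤ (E ⧸ N) →ₗ[ℤ] MonoidAlgebra ℤ E :=
  addExt fun g => MonoidAlgebra.of ℤ E (sec N g)

theorem asec_of (g : E ⧸ N) :
    asec N (MonoidAlgebra.of ℤ (E ⧸ N) g) = MonoidAlgebra.of ℤ E (sec N g) :=
  addExt_of _ g

theorem proj_asec (b : MonoidAlgebra ℤ (E ⧸ N)) : proj N (asec N b) = b := by
  have h : (proj N).toLinearMap.comp (asec N) = LinearMap.id := linearMap_ext_of fun g => by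
    simp only [LinearMap.comp_apply, asec_of, AlgHom.toLinearMap_apply, proj_of, mk_sec,
      LinearMap.id_apply]
  exact LinearMap.congr_fun h b

theorem lift_one_proj (a : MonoidAlgebra ℤ E) :
    MonoidAlgebra.lift ℤ ℤ (E ⧸ N) (1 : E ⧸ N →* ℤ) (proj N a) =
      MonoidAlgebra.lift ℤ ℤ E (1 : E →* ℤ) a := by
  have h : (MonoidAlgebra.lift ℤ ℤ (E ⧸ N) (1 : E ⧸ N →* ℤ)).toLinearMap.comp
      (proj N).toLinearMap = (MonoidAlgebra.lift ℤ ℤ E (1 : E →* ℤ)).toLinearMap :=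
    linearMap_ext_of fun g => by
      simp only [LinearMap.comp_apply, AlgHom.toLinearMap_apply, proj_of, MonoidAlgebra.lift_of,
        MonoidHom.one_apply]
  exact LinearMap.congr_fun h a

theorem proj_mem_augIdeal {a : MonoidAlgebra ℤ E} :
    proj N a ∈ augIdeal (E ⧸ N) ↔ a ∈ augIdeal E := by
  simp only [augIdeal, RingHom.mem_ker]
  exact (lift_one_proj N a).congr_left

theorem asec_mem_augIdeal {b : MonoidAlgebra ℤ (E ⧸ N)} (hb : b ∈ augIdeal (E ⧸ N)) :
    asec N b ∈ augIdeal E := by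
  rw [← proj_mem_augIdeal N, proj_asec]
  exact hb

theorem proj_mem_pow {k : ℕ} {a : MonoidAlgebra ℤ E} (ha : a ∈ augIdeal E ^ k) :
    proj N a ∈ augIdeal (E ⧸ N) ^ k := by
  induction k generalizing a with
  | zero => simp [Submodule.pow_zero, Ideal.one_eq_top]
  | succ k ih =>
    rw [Submodule.pow_succ] at ha ⊢
    refine Submodule.smul_induction_on ha (fun x hx y hy => ?_) fun x y hx hy => ?_
    · rw [smul_eq_mul, map_mul]
      exact Ideal.mul_mem_mul (ih hx) ((proj_mem_augIdeal N).2 hy)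
    · rw [map_add]
      exact add_mem hx hy

/-- Products are lifted factor by factor. The lift of b is not taken to be `asec N b`, as `asec` is
not multiplicative. -/
theorem exists_mem_pow_proj_eq {k : ℕ} {b : MonoidAlgebra ℤ (E ⧸ N)}
    (hb : b ∈ augIdeal (E ⧸ N) ^ k) : ∃ a ∈ augIdeal E ^ k, proj N a = b := by
  induction k generalizing b with
  | zero => exact ⟨asec N b, by simp [Submodule.pow_zero, Ideal.one_eq_top], proj_asec N b⟩
  | succ k ih =>
    rw [Submodule.pow_succ] at hb ⊢
    refine Submodule.smul_induction_on hb (fun x hx y hy => ?_) fun x y hx hy => ?_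
    · obtain ⟨a, ha, rfl⟩ := ih hx
      refine ⟨a * asec N y, Ideal.mul_mem_mul ha (asec_mem_augIdeal N hy), ?_⟩
      rw [map_mul, proj_asec, smul_eq_mul]
    · obtain ⟨a, ha, rfl⟩ := hx
      obtain ⟨a', ha', rfl⟩ := hy
      exact ⟨a + a', add_mem ha ha', map_add _ _ _⟩

/-- The deviation `e s(eN)⁻¹ ∈ N` of `e ∈ E` from the section `s`. -/
def dev (e : E) : N :=
  ⟨e * (sec N e)⁻¹, by rw [← QuotientGroup.eq_one_iff]; simp [mk_sec]⟩

variable [IsMulCommutative N]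

/-- The additive map `ℤ[E] → N` extending `dev`. -/
def adev : MonoidAlgebra ℤ E →ₗ[ℤ] Additive N :=
  addExt fun e => Additive.ofMul (dev N e)

theorem adev_of (e : E) : adev N (MonoidAlgebra.of ℤ E e) = Additive.ofMul (dev N e) :=
  addExt_of _ e

theorem adev_of_sub_one (x : N) :
    adev N (MonoidAlgebra.of ℤ E (x : E) - 1) = Additive.ofMul x := by
  have h : ((x : E) : E ⧸ N) = 1 := (QuotientGroup.eq_one_iff _).2 x.2
  have h1 : dev N (x : E) = x := Subtype.ext (by simp [dev, h, sec_one])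
  have h2 : dev N 1 = 1 := Subtype.ext (by simp [dev, sec_one])
  rw [map_sub, ← map_one (MonoidAlgebra.of ℤ E), adev_of, adev_of, h1, h2, ofMul_one, sub_zero]

/-- The deviation is equivariant, `dev (x * e) = x * dev e` for x ∈ N, so the contributions of x to
(x - 1)(e - 1) cancel. -/
theorem adev_eq_zero {a : MonoidAlgebra ℤ E} (ha : a ∈ augMul N) : adev N a = 0 := by
  rw [augMul, subAug_eq_span, augIdeal_restrictScalars_eq_span, Submodule.span_mul_span] at ha
  induction ha using Submodule.span_induction with
  | mem a ha =>
    obtain ⟨_, ⟨x, hx, rfl⟩, _, ⟨e, rfl⟩, rfl⟩ := ha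
    have key (e : E) : dev N (x * e) = ⟨x, hx⟩ * dev N e := by
      have h : ((x * e : E) : E ⧸ N) = e := by
        rw [QuotientGroup.mk_mul, (QuotientGroup.eq_one_iff x).2 hx, one_mul]
      exact Subtype.ext (by simp [dev, h, mul_assoc])
    -- Writing x as `x * 1` lets equivariance apply to this term too.
    have e1 : (MonoidAlgebra.of ℤ E x - 1) * (MonoidAlgebra.of ℤ E e - 1) =
        MonoidAlgebra.of ℤ E (x * e) - MonoidAlgebra.of ℤ E (x * 1) -
          MonoidAlgebra.of ℤ E e + MonoidAlgebra.of ℤ E 1 := by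
      rw [map_mul, map_mul, map_one]; noncomm_ring
    simp only [e1, map_add, map_sub, adev_of]
    rw [key, key, ofMul_mul, ofMul_mul]
    abel
  | zero => exact map_zero _
  | add x y _ _ hx hy => rw [map_add, hx, hy, add_zero]
  | smul r x _ hx => rw [map_smul, hx, smul_zero]

/-- For e = ds with d the deviation and s the section value, e - s - (d - 1) = (d - 1)(s - 1) ∈ 𝔫𝔢.
Extending additively, a ≡ s(proj a) + (adev a - 1) for every a, and the first term vanishes here. -/
theorem mkQ_eq_augClass_adev {a : MonoidAlgebra ℤ E} (ha : proj N a = 0) :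
    (augMul N).mkQ a = augClass N (adev N a) := by
  have h : (augMul N).mkQ.comp (LinearMap.id - (asec N).comp (proj N).toLinearMap) =
      (augClass N).toIntLinearMap.comp (adev N) := linearMap_ext_of fun e => by
    simp only [LinearMap.comp_apply, LinearMap.sub_apply, LinearMap.id_apply,
      AlgHom.toLinearMap_apply, proj_of, asec_of, adev_of, AddMonoidHom.coe_toIntLinearMap]
    rw [augClass_ofMul, ← sub_eq_zero, ← map_sub, Submodule.mkQ_apply,
      Submodule.Quotient.mk_eq_zero]
    have e1 : MonoidAlgebra.of ℤ E e - MonoidAlgebra.of ℤ E (sec N e) -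
        (MonoidAlgebra.of ℤ E (dev N e : E) - 1) =
        (MonoidAlgebra.of ℤ E (dev N e : E) - 1) * (MonoidAlgebra.of ℤ E (sec N e) - 1) := by
      have : MonoidAlgebra.of ℤ E e =
          MonoidAlgebra.of ℤ E (dev N e : E) * MonoidAlgebra.of ℤ E (sec N e) := by
        rw [← map_mul]; simp [dev]
      rw [this]; noncomm_ring
    rw [e1]
    exact Submodule.mul_mem_mul (of_sub_one_mem_subAug (dev N e).2) (of_sub_one_mem _)
  have := LinearMap.congr_fun h a
  simpa [ha] using this

theorem of_adev_sub_one_sub_mem {a : MonoidAlgebra ℤ E} (ha : proj N a = 0) :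
    MonoidAlgebra.of ℤ E ((adev N a).toMul : E) - 1 - a ∈ augMul N := by
  rw [← Submodule.Quotient.mk_eq_zero, ← Submodule.mkQ_apply, map_sub,
    mkQ_eq_augClass_adev N ha, sub_eq_zero]
  rfl

/-- Modulo 𝔫𝔢, which is stable under right multiplication, a is some x - 1 with x ∈ N. -/
theorem mul_mem_augMul_of_proj_eq_zero_left {a b : MonoidAlgebra ℤ E} (ha : proj N a = 0)
    (hb : b ∈ augIdeal E) : a * b ∈ augMul N := by
  have e : a * b = (MonoidAlgebra.of ℤ E ((adev N a).toMul : E) - 1) * b -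
      (MonoidAlgebra.of ℤ E ((adev N a).toMul : E) - 1 - a) * b := by noncomm_ring
  rw [e]
  refine sub_mem (Submodule.mul_mem_mul (of_sub_one_mem_subAug (adev N a).toMul.2) hb) ?_
  refine Submodule.mul_induction_on (of_adev_sub_one_sub_mem N ha) (fun p hp q hq => ?_)
    fun p q hp hq => ?_
  · rw [mul_assoc]
    exact Submodule.mul_mem_mul hp (Ideal.mul_mem_left (augIdeal E) q hb)
  · rw [add_mul]
    exact add_mem hp hq

/-- The mirror image needs centrality, which moves the factor from 𝔫 past a to the left. -/
theorem mul_mem_augMul_of_proj_eq_zero_right (hN : N ≤ Subgroup.center E)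
    {a b : MonoidAlgebra ℤ E} (ha : a ∈ augIdeal E) (hb : proj N b = 0) : a * b ∈ augMul N := by
  have e : a * b = (MonoidAlgebra.of ℤ E ((adev N b).toMul : E) - 1) * a -
      a * (MonoidAlgebra.of ℤ E ((adev N b).toMul : E) - 1 - b) := by
    rw [commute_of_mem_subAug hN (of_sub_one_mem_subAug (adev N b).toMul.2) a]; noncomm_ring
  rw [e]
  refine sub_mem (Submodule.mul_mem_mul (of_sub_one_mem_subAug (adev N b).toMul.2) ha) ?_
  refine Submodule.mul_induction_on (of_adev_sub_one_sub_mem N hb) (fun p hp q hq => ?_)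
    fun p q hp hq => ?_
  · rw [← mul_assoc, ← commute_of_mem_subAug hN hp, mul_assoc]
    exact Submodule.mul_mem_mul hp (Ideal.mul_mem_left (augIdeal E) a hq)
  · rw [mul_add]
    exact add_mem hp hq

/-- `s(bc)s(d) ≡ s(b)s(cd)` modulo `𝔫𝔢`, for the additive section `s`. -/
theorem asec_mul_sub_asec_mul_mem (hN : N ≤ Subgroup.center E) {b c d : MonoidAlgebra ℤ (E ⧸ N)}
    (hb : b ∈ augIdeal (E ⧸ N)) (hd : d ∈ augIdeal (E ⧸ N)) :
    asec N (b * c) * asec N d - asec N b * asec N (c * d) ∈ augMul N := by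
  -- Insert s(b)s(c)s(d): both multiplicativity defects of s project to 0, and each is multiplied by
  -- an element of 𝔢.
  have e : asec N (b * c) * asec N d - asec N b * asec N (c * d) =
      (asec N (b * c) - asec N b * asec N c) * asec N d +
        asec N b * (asec N c * asec N d - asec N (c * d)) := by noncomm_ring
  rw [e]
  refine add_mem (mul_mem_augMul_of_proj_eq_zero_left N ?_ (asec_mem_augIdeal N hd))
    (mul_mem_augMul_of_proj_eq_zero_right N hN (asec_mem_augIdeal N hb) ?_) <;>
  simp only [map_sub, map_mul, proj_asec, sub_self]

/-- Exchanging s(b) for a lift of b in 𝔢ᵐ⁺¹ costs only an element of the kernel of the projection,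
which s(c) ∈ 𝔢 carries into 𝔫𝔢. This and its right-hand analogue make the pairing (b, c) ↦ s(b)s(c)
descend to the polynomial quotients. -/
theorem asec_mul_asec_mem_relAug_left {m : ℕ} {b c : MonoidAlgebra ℤ (E ⧸ N)}
    (hb : b ∈ augIdeal (E ⧸ N) ^ (m + 1)) (hc : c ∈ augIdeal (E ⧸ N)) :
    asec N b * asec N c ∈ relAug (m + 2) N := by
  obtain ⟨a, ha, rfl⟩ := exists_mem_pow_proj_eq N hb
  have e : asec N (proj N a) * asec N c =
      (asec N (proj N a) - a) * asec N c + a * asec N c := by noncomm_ring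
  rw [e]
  refine add_mem (augMul_le_relAug N _ (mul_mem_augMul_of_proj_eq_zero_left N ?_
    (asec_mem_augIdeal N hc))) (mem_relAug_of_mem_pow N ?_)
  · rw [map_sub, proj_asec, sub_self]
  · rw [Submodule.pow_succ]
    exact Ideal.mul_mem_mul ha (asec_mem_augIdeal N hc)

theorem asec_mul_asec_mem_relAug_right (hN : N ≤ Subgroup.center E) {n : ℕ}
    {b c : MonoidAlgebra ℤ (E ⧸ N)} (hb : b ∈ augIdeal (E ⧸ N))
    (hc : c ∈ augIdeal (E ⧸ N) ^ n) : asec N b * asec N c ∈ relAug n N := by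
  obtain ⟨a, ha, rfl⟩ := exists_mem_pow_proj_eq N hc
  have e : asec N b * asec N (proj N a) =
      asec N b * (asec N (proj N a) - a) + asec N b * a := by noncomm_ring
  rw [e]
  refine add_mem (augMul_le_relAug N _ (mul_mem_augMul_of_proj_eq_zero_right N hN
    (asec_mem_augIdeal N hb) ?_)) (mem_relAug_of_mem_pow N (Ideal.mul_mem_left _ _ ha))
  rw [map_sub, proj_asec, sub_self]

end CentralExtension

/-! ### The transgression of a central extension -/

section Transgression

variable {E : Type u} [Group E] (N : Subgroup E) [N.Normal]

/-- The map `[g | h] ↦ (s(g) - 1)(s(h) - 1)` from 2-chains of `E/N` to `ℤ[E]`. -/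
def chainLift : ((E ⧸ N) × (E ⧸ N) →₀ ULift.{u} ℤ) →ₗ[ULift.{u} ℤ] MonoidAlgebra ℤ E :=
  Finsupp.linearCombination (ULift.{u} ℤ) fun p => asec N (dif p.1).1 * asec N (dif p.2).1

theorem chainLift_single (g h : E ⧸ N) (c : ULift.{u} ℤ) :
    chainLift N (Finsupp.single (g, h) c) = c • (asec N (dif g).1 * asec N (dif h).1) :=
  Finsupp.linearCombination_single _ _ _

/-- This is (g - 1)(h - 1) = (gh - 1) - (g - 1) - (h - 1), the negative of the bar boundary under
[g] ↦ g - 1. -/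
theorem proj_chainLift (x : (E ⧸ N) × (E ⧸ N) →₀ ULift.{u} ℤ) :
    proj N (chainLift N x) =
      -Finsupp.linearCombination (ULift.{u} ℤ) (fun g : E ⧸ N => (dif g).1)
        ((groupHomology.d₂₁ (trivZ (E ⧸ N))).hom x) := by
  induction x using Finsupp.induction_linear with
  | zero => simp
  | add x y hx hy =>
    rw [map_add, map_add, hx, hy, ← neg_add, ← map_add]
    exact congrArg (fun t => -Finsupp.linearCombination (ULift.{u} ℤ)
      (fun g : E ⧸ N => (dif g).1) t)
        (map_add (groupHomology.d₂₁ (trivZ (E ⧸ N))).hom x y).symm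
  | single p c =>
    obtain ⟨g, h⟩ := p
    have e : (groupHomology.d₂₁ (trivZ (E ⧸ N))).hom (Finsupp.single (g, h) c) =
        (Finsupp.single h c - Finsupp.single (g * h) c + Finsupp.single g c :
          (E ⧸ N) →₀ ULift.{u} ℤ) :=
      groupHomology.d₂₁_single (A := trivZ (E ⧸ N)) (g, h) c
    refine Eq.trans ?_ (congrArg (fun t => -Finsupp.linearCombination (ULift.{u} ℤ)
      (fun g : E ⧸ N => (dif g).1) t) e.symm)
    simp only [map_add, map_sub, Finsupp.linearCombination_single]
    rw [chainLift_single, map_usmul, map_mul, proj_asec, proj_asec, ← smul_sub, ← smul_add,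
      ← smul_neg, dif_mul]
    congr 1
    simp only [Submodule.coe_add, Submodule.coe_smul, smul_eq_mul]
    abel

theorem proj_chainLift_eq_zero (x : groupHomology.cycles₂ (trivZ (E ⧸ N))) :
    proj N (chainLift N x.1) = 0 := by
  have hx : (groupHomology.d₂₁ (trivZ (E ⧸ N))).hom x.1 = 0 := x.2
  refine (proj_chainLift N x.1).trans ?_
  refine (congrArg (fun t => -Finsupp.linearCombination (ULift.{u} ℤ)
    (fun g : E ⧸ N => (dif g).1) t) hx).trans ?_
  simp

variable [IsMulCommutative N]

theorem chainLift_d₃₂_mem (hN : N ≤ Subgroup.center E)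
    (x : (E ⧸ N) × (E ⧸ N) × (E ⧸ N) →₀ ULift.{u} ℤ) :
    chainLift N ((groupHomology.d₃₂ (trivZ (E ⧸ N))).hom x) ∈ augMul N := by
  induction x using Finsupp.induction_linear with
  | zero =>
    have e := map_zero (groupHomology.d₃₂ (trivZ (E ⧸ N))).hom
    rw [show chainLift N ((groupHomology.d₃₂ (trivZ (E ⧸ N))).hom 0) = 0 from
      (congrArg (chainLift N) e).trans (map_zero _)]
    exact zero_mem _
  | add x y hx hy =>
    have e := map_add (groupHomology.d₃₂ (trivZ (E ⧸ N))).hom x y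
    rw [show chainLift N ((groupHomology.d₃₂ (trivZ (E ⧸ N))).hom (x + y)) = _ from
      (congrArg (chainLift N) e).trans (map_add (chainLift N) _ _)]
    exact add_mem hx hy
  | single p c =>
    obtain ⟨g, h, k⟩ := p
    have e : (groupHomology.d₃₂ (trivZ (E ⧸ N))).hom (Finsupp.single (g, h, k) c) =
        (Finsupp.single (h, k) c - Finsupp.single (g * h, k) c + Finsupp.single (g, h * k) c
          - Finsupp.single (g, h) c : (E ⧸ N) × (E ⧸ N) →₀ ULift.{u} ℤ) :=
      groupHomology.d₃₂_single (A := trivZ (E ⧸ N)) (g, h, k) c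
    rw [show chainLift N ((groupHomology.d₃₂ (trivZ (E ⧸ N))).hom (Finsupp.single (g, h, k) c)) =
      _ from congrArg (chainLift N) e]
    simp only [map_add, map_sub, chainLift_single]
    rw [← smul_sub, ← smul_add, ← smul_sub, ULift.smul_def]
    refine Submodule.smul_mem _ c.down ?_
    -- Expanding gh - 1 and hk - 1, all quadratic terms cancel, leaving minus the associativity
    -- defect of s at g - 1, h - 1, k - 1.
    have key := asec_mul_sub_asec_mul_mem N hN (c := (dif h).1) (dif g).2 (dif k).2
    rw [← neg_mem_iff] at key
    convert key using 1
    simp only [dif_mul, Submodule.coe_add, Submodule.coe_smul, smul_eq_mul, map_add, add_mul,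
      mul_add]
    abel

/-- The transgression `H₂(E/N) → N` of a central extension. -/
def transgression (hN : N ≤ Subgroup.center E) :
    groupHomology.H2 (trivZ (E ⧸ N)) →+ Additive N :=
  AddMonoidHom.liftOfSurjective (cyclesToH2 (E ⧸ N)) (cyclesToH2_surjective (E ⧸ N))
    ⟨{ toFun := fun x => adev N (chainLift N x.1)
       map_zero' := (congrArg (adev N) (map_zero (chainLift N))).trans (map_zero _)
       map_add' := fun x y =>
        (congrArg (adev N) (map_add (chainLift N) x.1 y.1)).trans (map_add _ _ _) },
    fun x hx => by
      obtain ⟨y, hy⟩ := (cyclesToH2_eq_zero (E ⧸ N)).1 hx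
      refine adev_eq_zero N ?_
      rw [← hy]
      exact chainLift_d₃₂_mem N hN y⟩

theorem transgression_cyclesToH2 (hN : N ≤ Subgroup.center E)
    (x : groupHomology.cycles₂ (trivZ (E ⧸ N))) :
    transgression N hN (cyclesToH2 (E ⧸ N) x) = adev N (chainLift N x.1) :=
  AddMonoidHom.liftOfRightInverse_comp_apply _ _ _ _ x

/-- The link between the group and ring sides: the lift of a cycle lies in the kernel of the
projection, where `adev` is inverse to x ↦ x - 1 modulo 𝔫𝔢. -/
theorem of_transgression_sub_one_sub_mem (hN : N ≤ Subgroup.center E)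
    (x : groupHomology.cycles₂ (trivZ (E ⧸ N))) :
    MonoidAlgebra.of ℤ E ((transgression N hN (cyclesToH2 (E ⧸ N) x)).toMul : E) - 1 -
      chainLift N x.1 ∈ augMul N := by
  rw [transgression_cyclesToH2]
  exact of_adev_sub_one_sub_mem N (proj_chainLift_eq_zero N x)

end Transgression

/-! ### Removing the coefficient factor from coinvariants -/

section Contraction

variable {A : Type u} [Ring A] (J : Ideal A)

/-- The additive map `J/Jᵏ → M` induced by an additive map `J → M` that vanishes on `Jᵏ`. -/
def powQuotLift {k : ℕ} {M : Type u} [AddCommGroup M] (f : J →+ M)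
    (hf : ∀ a : J, (a : A) ∈ J ^ k → f a = 0) : PowQuot J k →+ M :=
  AddMonoidHom.liftOfSurjective (pmk J k).toAddMonoidHom (pmk_surjective J k)
    ⟨f, fun a ha => hf a ((pmk_eq_zero J).1 ha)⟩

theorem powQuotLift_pmk {k : ℕ} {M : Type u} [AddCommGroup M] (f : J →+ M)
    (hf : ∀ a : J, (a : A) ∈ J ^ k → f a = 0) (a : J) :
    powQuotLift J f hf (pmk J k a) = f a :=
  AddMonoidHom.liftOfRightInverse_comp_apply (pmk J k).toAddMonoidHom _ _ _ a

variable (ε : A →+* ℤ) (hε : J ≤ RingHom.ker ε) (k : ℕ)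

/-- The map `A/J^{k+1} → ℤ` induced by a ring homomorphism `A → ℤ` that vanishes on `J`. -/
def ringQuotLift : RingQuot J (k + 1) →+ ℤ :=
  AddMonoidHom.liftOfSurjective (rmk J (k + 1)).toAddMonoidHom (rmk_surjective J (k + 1))
    ⟨ε.toAddMonoidHom, fun _ ha => hε (Ideal.pow_le_self k.succ_ne_zero ((rmk_eq_zero J).1 ha))⟩

theorem ringQuotLift_rmk (a : A) : ringQuotLift J ε hε k (rmk J (k + 1) a) = ε a :=
  AddMonoidHom.liftOfRightInverse_comp_apply (rmk J (k + 1)).toAddMonoidHom _ _ _ a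

variable (X : Type u) [AddCommGroup X]

/-- The map `A/J^{k+1} ⊗ X → X` induced by `ε`. -/
def preContract : RingQuot J (k + 1) ⊗[ℤ] X →ₗ[ℤ] X :=
  TensorProduct.lift ((LinearMap.lsmul ℤ X).comp (ringQuotLift J ε hε k).toIntLinearMap)

theorem preContract_tmul (a : A) (x : X) :
    preContract J ε hε k X (rmk J (k + 1) a ⊗ₜ x) = ε a • x := by
  rw [← ringQuotLift_rmk J ε hε k]
  rfl

theorem preContract_smul {r : A} (hr : r ∈ J) (t : RingQuot J (k + 1) ⊗[ℤ] X) :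
    preContract J ε hε k X (r • t) = 0 := by
  induction t using TensorProduct.induction_on with
  | zero => rw [smul_zero, map_zero]
  | add s t hs ht => rw [smul_add, map_add, hs, ht, add_zero]
  | tmul a x =>
    obtain ⟨a, rfl⟩ := rmk_surjective J _ a
    have h0 : ε r = 0 := hε hr
    rw [TensorProduct.smul_tmul', ← map_smul, preContract_tmul, smul_eq_mul, map_mul, h0,
      zero_mul, zero_smul]

/-- The map `ℤ ⊗_A (A/J^{k+1} ⊗ X) → X` induced by `ε`. -/
def contract : Coinv J (RingQuot J (k + 1) ⊗[ℤ] X) →+ X :=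
  AddMonoidHom.liftOfSurjective (cmk J (M := RingQuot J (k + 1) ⊗[ℤ] X)).toAddMonoidHom
    (cmk_surjective J) ⟨(preContract J ε hε k X).toAddMonoidHom, fun _ ht =>
      Submodule.smul_induction_on ((cmk_eq_zero J).1 ht)
        (fun _ hr _ _ => preContract_smul J ε hε k X hr _) fun _ _ hs ht => add_mem hs ht⟩

theorem contract_cmk_tmul (a : A) (x : X) :
    contract J ε hε k X (cmk J (rmk J (k + 1) a ⊗ₜ x)) = ε a • x :=
  (AddMonoidHom.liftOfRightInverse_comp_apply
    (cmk J (M := RingQuot J (k + 1) ⊗[ℤ] X)).toAddMonoidHom _ _ _ _).trans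
    (preContract_tmul J ε hε k X a x)

end Contraction

theorem augIdeal_le_ker (G : Type u) [Group G] :
    augIdeal G ≤ RingHom.ker (MonoidAlgebra.lift ℤ ℤ G (1 : G →* ℤ)).toRingHom := le_rfl

/-! ### Factoring the transgression through polynomial chains -/

section Pairing

variable {E : Type u} [Group E] (N : Subgroup E) [N.Normal] [IsMulCommutative N]
  (hN : N ≤ Subgroup.center E) (m : ℕ)

/-- The map `c ↦ s(b)s(c)` from `𝔤/𝔤ⁿ` to `ℤ[E]/(𝔫𝔢 + 𝔢ⁿ)`, where `G = E/N`. -/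
def asecPairingRight (b : augIdeal (E ⧸ N)) :
    PowQuot (augIdeal (E ⧸ N)) (m + 2) →+ MonoidAlgebra ℤ E ⧸ relAug (m + 2) N :=
  powQuotLift _ (((relAug (m + 2) N).mkQ.comp
    ((LinearMap.mulLeft ℤ (asec N b.1)).comp (asec N))).toAddMonoidHom.comp
      (augIdeal (E ⧸ N)).subtype.toAddMonoidHom) fun _ hc =>
    (Submodule.Quotient.mk_eq_zero _).2 (asec_mul_asec_mem_relAug_right N hN b.2 hc)

theorem asecPairingRight_pmk (b c : augIdeal (E ⧸ N)) :
    asecPairingRight N hN m b (pmk _ (m + 2) c) =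
      (relAug (m + 2) N).mkQ (asec N b.1 * asec N c.1) :=
  powQuotLift_pmk _ _ _ c

/-- The biadditive map `(b, c) ↦ s(b)s(c)` from `𝔤/𝔤ⁿ⁻¹ × 𝔤/𝔤ⁿ` to `ℤ[E]/(𝔫𝔢 + 𝔢ⁿ)`, where
`G = E/N`. -/
def asecPairing : PowQuot (augIdeal (E ⧸ N)) (m + 1) →+
    PowQuot (augIdeal (E ⧸ N)) (m + 2) →+ MonoidAlgebra ℤ E ⧸ relAug (m + 2) N :=
  powQuotLift (augIdeal (E ⧸ N))
    (AddMonoidHom.mk' (asecPairingRight N hN m) (by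
      intro b b'
      ext c
      obtain ⟨c, rfl⟩ := pmk_surjective _ _ c
      rw [AddMonoidHom.add_apply]
      simp only [asecPairingRight_pmk]
      rw [← map_add, ← add_mul, ← map_add]
      rfl)) (by
    intro b hb
    ext c
    obtain ⟨c, rfl⟩ := pmk_surjective _ _ c
    refine (asecPairingRight_pmk N hN m b c).trans ?_
    exact (Submodule.Quotient.mk_eq_zero _).2 (asec_mul_asec_mem_relAug_left N hb c.2))

theorem asecPairing_pmk (b c : augIdeal (E ⧸ N)) :
    asecPairing N hN m (pmk _ (m + 1) b) (pmk _ (m + 2) c) =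
      (relAug (m + 2) N).mkQ (asec N b.1 * asec N c.1) :=
  (DFunLike.congr_fun (powQuotLift_pmk (augIdeal (E ⧸ N)) _ _ b) _).trans
    (asecPairingRight_pmk N hN m b c)

/-- The map `1 ⊗ b ⊗ c ↦ s(b)s(c)` from 2-chains of the polynomial bar construction to
`ℤ[E]/(𝔫𝔢 + 𝔢ⁿ)`. -/
def polyChainLift : Coinv (augIdeal (E ⧸ N)) (PB2 (augIdeal (E ⧸ N)) m) →+
    MonoidAlgebra ℤ E ⧸ relAug (m + 2) N :=
  (TensorProduct.liftAddHom (asecPairing N hN m) fun r b c => by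
    rw [map_zsmul, map_zsmul, AddMonoidHom.smul_apply]).comp
    (contract (augIdeal (E ⧸ N)) (MonoidAlgebra.lift ℤ ℤ (E ⧸ N) (1 : E ⧸ N →* ℤ)).toRingHom
      (augIdeal_le_ker _) m _)

theorem polyChainLift_cmk (a : MonoidAlgebra ℤ (E ⧸ N)) (b c : augIdeal (E ⧸ N)) :
    polyChainLift N hN m (cmk _ (rmk _ (m + 1) a ⊗ₜ (pmk _ (m + 1) b ⊗ₜ pmk _ (m + 2) c))) =
      MonoidAlgebra.lift ℤ ℤ (E ⧸ N) (1 : E ⧸ N →* ℤ) a •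
        (relAug (m + 2) N).mkQ (asec N b.1 * asec N c.1) := by
  rw [polyChainLift, AddMonoidHom.comp_apply, contract_cmk_tmul, map_zsmul,
    TensorProduct.liftAddHom_tmul, asecPairing_pmk]
  rfl

theorem polyChainLift_rhoChain2 (x : (E ⧸ N) × (E ⧸ N) →₀ ULift.{u} ℤ) :
    polyChainLift N hN m (rhoChain2 (E ⧸ N) m x) = (relAug (m + 2) N).mkQ (chainLift N x) := by
  induction x using Finsupp.induction_linear with
  | zero => simp
  | add x y hx hy => simp only [map_add, hx, hy]
  | single p c =>
    rw [rhoChain2, Finsupp.linearCombination_single, map_usmul, chainLift_single, map_usmul,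
      rhoGen2, polyChainLift_cmk, map_one, one_smul]

/-- The face multiplying into the coefficients dies under the augmentation; the other two differ by
s(bc)s(d) - s(b)s(cd), up to an integer factor. -/
theorem polyChainLift_delta3 (y : Coinv (augIdeal (E ⧸ N)) (PB3 (augIdeal (E ⧸ N)) m)) :
    polyChainLift N hN m (coinvMap _ (delta3 (augIdeal (E ⧸ N)) m) y) = 0 := by
  obtain ⟨y, rfl⟩ := cmk_surjective _ y
  rw [coinvMap_cmk]
  induction y using TensorProduct.induction_on with
  | zero => simp only [map_zero]
  | add x y hx hy => simp only [map_add, hx, hy, add_zero]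
  | tmul a x =>
    induction x using TensorProduct.induction_on with
    | zero => simp only [TensorProduct.tmul_zero, map_zero]
    | add x y hx hy => simp only [TensorProduct.tmul_add, map_add, hx, hy, add_zero]
    | tmul b x =>
      induction x using TensorProduct.induction_on with
      | zero => simp only [TensorProduct.tmul_zero, map_zero]
      | add x y hx hy => simp only [TensorProduct.tmul_add, map_add, hx, hy, add_zero]
      | tmul c d =>
        obtain ⟨a, rfl⟩ := rmk_surjective _ _ a
        obtain ⟨b, rfl⟩ := pmk_surjective _ _ b
        obtain ⟨c, rfl⟩ := pmk_surjective _ _ c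
        obtain ⟨d, rfl⟩ := pmk_surjective _ _ d
        have hb : MonoidAlgebra.lift ℤ ℤ (E ⧸ N) (1 : E ⧸ N →* ℤ) b.1 = 0 := b.2
        rw [delta3_tmul]
        simp only [map_add, map_sub, polyChainLift_cmk, map_mul, hb, mul_zero, zero_smul, zero_sub]
        rw [neg_add_eq_zero, ← sub_eq_zero, ← smul_sub, ← map_sub]
        refine (congrArg _ ((Submodule.Quotient.mk_eq_zero _).2 (augMul_le_relAug N _
          (asec_mul_sub_asec_mul_mem N hN b.2 d.2)))).trans (smul_zero _)

theorem chainLift_mem_relAug (hN : N ≤ Subgroup.center E) (m : ℕ)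
    (x : groupHomology.cycles₂ (trivZ (E ⧸ N)))
    (hx : rho (E ⧸ N) m (cyclesToH2 (E ⧸ N) x) = 0) : chainLift N x.1 ∈ relAug (m + 2) N := by
  rw [rho_cyclesToH2] at hx
  obtain ⟨y, hy⟩ := (hmk_eq_zero _ _).1 hx
  have h := polyChainLift_delta3 N hN m y
  rw [hy] at h
  exact (Submodule.Quotient.mk_eq_zero _).1 ((polyChainLift_rhoChain2 N hN m x.1).symm.trans h)

theorem transgression_mem_relDim (hN : N ≤ Subgroup.center E) (m : ℕ)
    (z : groupHomology.H2 (trivZ (E ⧸ N))) (hz : rho (E ⧸ N) m z = 0) :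
    ((transgression N hN z).toMul : E) ∈ relDim (m + 2) N := by
  obtain ⟨x, rfl⟩ := cyclesToH2_surjective (E ⧸ N) z
  rw [mem_relDim, ← sub_add_cancel (MonoidAlgebra.of ℤ E _ - 1) (chainLift N x.1)]
  exact add_mem (augMul_le_relAug N _ (of_transgression_sub_one_sub_mem N hN x))
    (chainLift_mem_relAug N hN m x hz)

end Pairing

/-! ### Realising elements of D_n(E, N) ∩ N by cycles -/

section Surjectivity

/-- The differential from 2-chains to 1-chains, on finitely supported functions. -/
def bdry2 (G : Type u) [Group G] : (G × G →₀ ULift.{u} ℤ) →ₗ[ULift.{u} ℤ] (G →₀ ULift.{u} ℤ) :=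
  (groupHomology.d₂₁ (trivZ G)).hom

theorem bdry2_single {G : Type u} [Group G] (g h : G) (c : ULift.{u} ℤ) :
    bdry2 G (Finsupp.single (g, h) c) =
      Finsupp.single h c - Finsupp.single (g * h) c + Finsupp.single g c :=
  groupHomology.d₂₁_single (A := trivZ G) (g, h) c

/-- The 1-chain `Σ c_g [g]` of an element `Σ c_g g` of the group ring. -/
def toChain1 {G : Type u} [Group G] : MonoidAlgebra ℤ G →ₗ[ℤ] (G →₀ ULift.{u} ℤ) :=
  addExt fun g => Finsupp.single g 1

variable {E : Type u} [Group E] (N : Subgroup E) [N.Normal]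

theorem exists_chain_dif_dif (g h : E ⧸ N) (m : ℕ) :
    ∃ x : (E ⧸ N) × (E ⧸ N) →₀ ULift.{u} ℤ,
      chainLift N x = asec N (dif g).1 * asec N (dif h).1 ∧
      rhoChain2 (E ⧸ N) m x = rhoGen2 (E ⧸ N) m (g, h) ∧
      bdry2 (E ⧸ N) x = -toChain1 ((dif g).1 * (dif h).1) := by
  have h1 : dif (1 : E ⧸ N) = 0 := Subtype.ext (sub_eq_zero.2 (map_one _))
  -- The correction [1 | 1] is invisible to both lifts because 1 - 1 = 0, but its boundary [1]
  -- supplies the constant term of (g - 1)(h - 1).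
  refine ⟨Finsupp.single (g, h) 1 - Finsupp.single (1, 1) 1, ?_, ?_, ?_⟩
  · rw [map_sub, chainLift_single, chainLift_single, h1]
    simp
  · rw [map_sub, rhoChain2, Finsupp.linearCombination_single, Finsupp.linearCombination_single,
      one_smul, one_smul, sub_eq_self, rhoGen2, h1]
    simp only [map_zero, TensorProduct.tmul_zero]
  · have e1 : (dif g).1 * (dif h).1 = MonoidAlgebra.of ℤ (E ⧸ N) (g * h) -
        MonoidAlgebra.of ℤ (E ⧸ N) g - MonoidAlgebra.of ℤ (E ⧸ N) h +
        MonoidAlgebra.of ℤ (E ⧸ N) 1 := by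
      simp only [dif, map_mul, map_one]; noncomm_ring
    rw [e1]
    simp only [map_add, map_sub, bdry2_single, toChain1, addExt_of, mul_one]
    abel

/-- All three conditions are biadditive in (a, b), so the case of differences suffices. One chain
must meet them together, as the boundary condition is what later yields a cycle. -/
theorem exists_chain (a b : augIdeal (E ⧸ N)) (m : ℕ) :
    ∃ x : (E ⧸ N) × (E ⧸ N) →₀ ULift.{u} ℤ,
      chainLift N x = asec N a.1 * asec N b.1 ∧
      rhoChain2 (E ⧸ N) m x =
        cmk _ (rmk _ (m + 1) 1 ⊗ₜ (pmk _ (m + 1) a ⊗ₜ pmk _ (m + 2) b)) ∧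
      bdry2 (E ⧸ N) x = -toChain1 (a.1 * b.1) := by
  induction a using augIdeal_induction with
  | hd g =>
    induction b using augIdeal_induction with
    | hd h => exact exists_chain_dif_dif N g h m
    | h0 => exact ⟨0, by simp, by simp, by simp⟩
    | hadd b b' hb hb' =>
      obtain ⟨x, hx, hx', hx''⟩ := hb
      obtain ⟨y, hy, hy', hy''⟩ := hb'
      refine ⟨x + y, ?_, ?_, ?_⟩
      · simp only [map_add, hx, hy, Submodule.coe_add, mul_add]
      · simp only [map_add, hx', hy', TensorProduct.tmul_add]
      · simp only [map_add, hx'', hy'', Submodule.coe_add, mul_add, neg_add]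
    | hneg b hb =>
      obtain ⟨x, hx, hx', hx''⟩ := hb
      refine ⟨-x, ?_, ?_, ?_⟩
      · simp only [map_neg, hx, Submodule.coe_neg, mul_neg]
      · simp only [map_neg, hx', TensorProduct.tmul_neg]
      · simp only [map_neg, hx'', Submodule.coe_neg, mul_neg]
  | h0 => exact ⟨0, by simp, by simp, by simp⟩
  | hadd a a' ha ha' =>
    obtain ⟨x, hx, hx', hx''⟩ := ha
    obtain ⟨y, hy, hy', hy''⟩ := ha'
    refine ⟨x + y, ?_, ?_, ?_⟩
    · simp only [map_add, hx, hy, Submodule.coe_add, add_mul]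
    · simp only [map_add, hx', hy', TensorProduct.tmul_add, TensorProduct.add_tmul]
    · simp only [map_add, hx'', hy'', Submodule.coe_add, add_mul, neg_add]
  | hneg a ha =>
    obtain ⟨x, hx, hx', hx''⟩ := ha
    refine ⟨-x, ?_, ?_, ?_⟩
    · simp only [map_neg, hx, Submodule.coe_neg, neg_mul]
    · simp only [map_neg, hx', TensorProduct.tmul_neg, TensorProduct.neg_tmul]
    · simp only [map_neg, hx'', Submodule.coe_neg, neg_mul]

theorem proj_eq_zero_of_mem_augMul {a : MonoidAlgebra ℤ E} (ha : a ∈ augMul N) :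
    proj N a = 0 := by
  have h (x : MonoidAlgebra ℤ E) (hx : x ∈ subAug N) : proj N x = 0 := by
    rw [subAug_eq_span] at hx
    induction hx using Submodule.span_induction with
    | mem x hx =>
      obtain ⟨g, hg, rfl⟩ := hx
      rw [map_sub, proj_of, (QuotientGroup.eq_one_iff g).2 hg, map_one, map_one, sub_self]
    | zero => exact map_zero _
    | add x y _ _ hx hy => rw [map_add, hx, hy, add_zero]
    | smul r x _ hx => rw [map_smul, hx, smul_zero]
  refine Submodule.mul_induction_on ha (fun p hp q _ => ?_) fun p q hp hq => ?_
  · rw [map_mul, h p hp, zero_mul]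
  · rw [map_add, hp, hq, add_zero]

variable [IsMulCommutative N]

/-- Split v into products ab with a ∈ 𝔢ᵐ⁺¹: the image of a vanishes in 𝔤/𝔤ᵐ⁺¹, so the polynomial
image is zero already as a chain. -/
theorem exists_chain_of_mem_pow (hN : N ≤ Subgroup.center E) (m : ℕ) {v : MonoidAlgebra ℤ E}
    (hv : v ∈ augIdeal E ^ (m + 2)) :
    ∃ x : (E ⧸ N) × (E ⧸ N) →₀ ULift.{u} ℤ, v - chainLift N x ∈ augMul N ∧
      rhoChain2 (E ⧸ N) m x = 0 ∧ bdry2 (E ⧸ N) x = -toChain1 (proj N v) := by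
  rw [Submodule.pow_succ] at hv
  refine Submodule.smul_induction_on hv (fun a ha b hb => ?_) fun v w hv hw => ?_
  · have ha' : a ∈ augIdeal E := Ideal.pow_le_self m.succ_ne_zero ha
    obtain ⟨x, hx, hx', hx''⟩ := exists_chain N ⟨proj N a, (proj_mem_augIdeal N).2 ha'⟩
      ⟨proj N b, (proj_mem_augIdeal N).2 hb⟩ m
    refine ⟨x, ?_, ?_, ?_⟩
    · have e : a * b - asec N (proj N a) * asec N (proj N b) =
          (a - asec N (proj N a)) * b + asec N (proj N a) * (b - asec N (proj N b)) := by
        noncomm_ring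
      rw [hx, smul_eq_mul, e]
      refine add_mem (mul_mem_augMul_of_proj_eq_zero_left N ?_ hb)
        (mul_mem_augMul_of_proj_eq_zero_right N hN
          (asec_mem_augIdeal N ((proj_mem_augIdeal N).2 ha')) ?_) <;>
      rw [map_sub, proj_asec, sub_self]
    · rw [hx', (pmk_eq_zero _).2 (proj_mem_pow N ha), TensorProduct.zero_tmul,
        TensorProduct.tmul_zero, map_zero]
    · rw [hx'', smul_eq_mul, map_mul (proj N)]
  · obtain ⟨x, hx, hx', hx''⟩ := hv
    obtain ⟨y, hy, hy', hy''⟩ := hw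
    refine ⟨x + y, ?_, ?_, ?_⟩
    · rw [map_add, add_sub_add_comm]
      exact add_mem hx hy
    · rw [map_add, hx', hy', add_zero]
    · simp only [map_add, hx'', hy'', neg_add]

theorem exists_transgression_eq (hN : N ≤ Subgroup.center E) (m : ℕ) (x : N)
    (hx : (x : E) ∈ relDim (m + 2) N) :
    ∃ z : groupHomology.H2 (trivZ (E ⧸ N)), rho (E ⧸ N) m z = 0 ∧
      transgression N hN z = Additive.ofMul x := by
  obtain ⟨p, hp, q, hq, hpq⟩ := Submodule.mem_sup.1 (mem_relDim.1 hx)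
  obtain ⟨c, hc, hc', hc''⟩ := exists_chain_of_mem_pow N hN m hq
  -- Both x - 1 and p project to 0, hence so does q; this makes the chain c a cycle.
  have hq0 : proj N q = 0 := by
    rw [← eq_sub_iff_add_eq'] at hpq
    rw [hpq, map_sub, proj_eq_zero_of_mem_augMul N hp, map_sub, proj_of,
      (QuotientGroup.eq_one_iff (x : E)).2 x.2, map_one, map_one, sub_self, sub_zero]
  rw [hq0, map_zero, neg_zero] at hc''
  let z : groupHomology.cycles₂ (trivZ (E ⧸ N)) := ⟨c, hc''⟩
  refine ⟨cyclesToH2 (E ⧸ N) z, ?_, ?_⟩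
  · rw [rho_cyclesToH2]
    exact (hmk_eq_zero _ _).2 ⟨0, (map_zero _).trans hc'.symm⟩
  · rw [transgression_cyclesToH2, ← adev_of_sub_one N x, ← hpq]
    have h1 : adev N q = adev N (chainLift N c) := by
      rw [← sub_eq_zero, ← map_sub]
      exact adev_eq_zero N hc
    rw [map_add, adev_eq_zero N hp, zero_add, h1]

end Surjectivity

/-! ### Centrality of Cγ_{n-1}(E) and the final surjection -/

section Main

/-- For a central subgroup `N` of `E`, the group `D_{m+2}(E, N) ∩ N` is the image of the kernel
of `ρ_m` under the transgression. -/
theorem exists_surjective_ker_rho {E : Type u} [Group E] (N : Subgroup E) [N.Normal]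
    (hN : N ≤ Subgroup.center E) (m : ℕ) :
    ∃ f : Multiplicative (rho (E ⧸ N) m).ker →* ↥(relDim (m + 2) N ⊓ N),
      Function.Surjective f := by
  have : IsMulCommutative N :=
    .of_comm fun a b => Subtype.ext (Subgroup.mem_center_iff.1 (hN b.2) a)
  refine ⟨MonoidHom.mk' (fun z => ⟨(transgression N hN z.toAdd.1).toMul,
    transgression_mem_relDim N hN m _ z.toAdd.2, Subtype.prop _⟩) fun z w => ?_, fun x => ?_⟩
  · refine Subtype.ext ?_
    simp
  · obtain ⟨z, hz, hzx⟩ := exists_transgression_eq N hN m ⟨x.1, x.2.2⟩ x.2.1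
    exact ⟨Multiplicative.ofAdd ⟨z, hz⟩, Subtype.ext (congrArg (fun t => (t.toMul : E)) hzx)⟩

theorem gam_le_center {E : Type u} [Group E] (m : ℕ) (hE : gam E (m + 2) = ⊥) :
    gam E (m + 1) ≤ Subgroup.center E := by
  have h : ⁅gam E (m + 1), (⊤ : Subgroup E)⁆ = ⊥ := hE
  rw [Subgroup.commutator_eq_bot_iff_le_centralizer] at h
  rwa [Subgroup.coe_top, Subgroup.centralizer_univ] at h

theorem gam_quotient_eq_bot {E : Type u} [Group E] {N : Subgroup E} [N.Normal] {k : ℕ}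
    (h : gam E k ≤ N) : gam (E ⧸ N) k = ⊥ := by
  have e := Subgroup.map_lowerCentralSeries (⊤ : Subgroup E) (QuotientGroup.mk' N) (k - 1)
  rw [Subgroup.map_top_of_surjective _ (QuotientGroup.mk'_surjective N)] at e
  rw [gam, ← e, Subgroup.map_eq_bot_iff, QuotientGroup.ker_mk']
  exact h

theorem relDim_sup_gam {E : Type u} [Group E] (C : Subgroup E) (m : ℕ) :
    relDim (m + 2) (C ⊔ gam E (m + 1)) = relDim (m + 2) C := by
  ext e
  rw [mem_relDim, mem_relDim, relAug_sup_gam]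

/-- The indices are separate variables tied by equations so that the truncated differences n - 1 and
n - 2 can be substituted inside dependent types. -/
theorem exists_surjective_ker_rho_relDim {E : Type u} [Group E] {n k m : ℕ} (hk : k = m + 1)
    (hn : n = m + 2) (hE : gam E n = ⊥) (C : Subgroup E) [C.Normal]
    (hC : C ≤ Subgroup.center E) :
    ∃ f : Multiplicative (rho (E ⧸ (C ⊔ gam E k)) m).ker →* ↥(relDim n C ⊓ (C ⊔ gam E k)),
      Function.Surjective f := by
  subst hk hn
  -- After this the dimension subgroup and the quotient refer to the same central subgroup.
  rw [← relDim_sup_gam C m]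
  exact exists_surjective_ker_rho _ (sup_le hC (gam_le_center m hE)) m

end Main

end DimSub

end

theorem mainTheorem10 {E : Type*} [Group E] (n : ℕ) (hn : 2 ≤ n)
    (hE : DimSub.gam E n = ⊥) (C : Subgroup E) (hC : C ≤ Subgroup.center E) :
    haveI : C.Normal := DimSub.normal_of_central hC
    DimSub.gam (E ⧸ (C ⊔ DimSub.gam E (n - 1))) (n - 1) = ⊥ ∧
    ∃ f : Multiplicative ((DimSub.rho (E ⧸ (C ⊔ DimSub.gam E (n - 1))) (n - 2)).ker) →*
        ↥(DimSub.relDim n C ⊓ (C ⊔ DimSub.gam E (n - 1))),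
      Function.Surjective f := by
  have : C.Normal := DimSub.normal_of_central hC
  exact ⟨DimSub.gam_quotient_eq_bot le_sup_right,
    DimSub.exists_surjective_ker_rho_relDim (by omega) (by omega) hE C hC⟩
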